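/- Let $\Omega$ be a totally ordered alphabet of size $q$, and let $m,q,k\ge 1$. A cycle $(s)$ is a nonempty word $s$ over $\Omega$ considered up to rotation; it is aperiodic if the $|s|$ rotations of $s$ are distinct. The number of occurrences of a nonempty word $w$ in an aperiodic cycle $(s)$ is the number of rotations $t$ of $s$ such that $w$ is a prefix of some power $t^r$, and the number of occurrences of $w$ in a finite multiset $\sigma$ of aperiodic cycles is the sum of these numbers over the cycles of $\sigma$, counted with multiplicity. Let $\mathrm{MCDB}(m,q,k)$ be the set of finite multisets of aperiodic cycles over $\Omega$ in which every word of length $k$ over $\Omega$ occurs exactly $m$ times. For a finite multiset $\sigma=(s_1)\cdots(s_r)$ of aperiodic cycles let $c=\operatorname{lcm}(|s_1|,\ldots,|s_r|)$ and let $T_E(\sigma)$ be the table whose rows are the words $t^{c/|s_i|}$, for each $i=1,\ldots,r$ and each of the $|s_i|$ rotations $t$ of $s_i$, sorted into lexicographic order (equal rows being repeated). The Extended Burrows–Wheeler Transform $\mathrm{EBWT}(\sigma)$ is the last column of $T_E(\sigma)$, read from top to bottom. Let $\mathcal{W}_{m,q}$ be the set of words over $\Omega$ that contain each letter of $\Omega$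 exactly $m$ times (for $\Omega=\{0,1,\ldots,q-1\}$, the permutations of $0^m1^m\cdots(q-1)^m$), and let $(\mathcal{W}_{m,q})^{N}$ be the set of concatenations of $N$ words of $\mathcal{W}_{m,q}$. Then: (a) The image of $\mathrm{MCDB}(m,q,k)$ under $\mathrm{EBWT}$ is $(\mathcal{W}_{m,q})^{q^{k-1}}$. (b) $\mathrm{MCDB}(m,q,k)$ is finite and $$|\mathrm{MCDB}(m,q,k)| = W(m,q,k) = \frac{(mq)!^{\,q^{k-1}}}{m!^{\,q^k}}.$$ -/

import Mathlib

namespace MultiDeBruijn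

/-- `wordPow s r` is the concatenation `s s ⋯ s` of `r` copies of the linear sequence `s`. -/
def wordPow {Ω : Type*} (s : List Ω) (r : ℕ) : List Ω :=
  (List.replicate r s).flatten

/-- A cycle `(s)` is aperiodic if `|s| > 0` and the `|s|` cyclic rotations of `s` are distinct.
Here `Cycle.lists` is the multiset of all `|s|` rotations of `s`. -/
def IsAperiodic {Ω : Type*} (s : Cycle Ω) : Prop :=
  0 < s.length ∧ s.lists.Nodup

/-- A multicyclic sequence is a multiset of aperiodic cycles. -/
def IsMulticyclic {Ω : Type*} (σ : Multiset (Cycle Ω)) : Prop :=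
  ∀ s ∈ σ, IsAperiodic s

open Classical in
/-- The number of occurrences of `w` in the cycle `(s)`: the number of rotations of `s`
(one for each `j = 0, …, |s| - 1`) some power of which has `w` as a prefix. -/
noncomputable def cycleOccurrences {Ω : Type*} (s : Cycle Ω) (w : List Ω) : ℕ :=
  s.lists.countP (fun t => ∃ r : ℕ, w <+: wordPow t r)

/-- The number of occurrences of `w` in a multiset of cycles, cycles being counted with their
multiplicity. -/
noncomputable def occurrences {Ω : Type*} (σ : Multiset (Cycle Ω)) (w : List Ω) : ℕ :=
  (σ.map (fun s => cycleOccurrences s w)).sum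

/-- Multicyclic de Bruijn sequences over `Ω`: multisets of aperiodic cycles in which every
`k`-mer over `Ω` occurs exactly `m` times. -/
def MCDB (Ω : Type*) (m k : ℕ) : Set (Multiset (Cycle Ω)) :=
  {σ | IsMulticyclic σ ∧ ∀ w : List Ω, w.length = k → occurrences σ w = m}

/-- The number of columns of the table of `σ`: the least common multiple of the cycle lengths. -/
def numColumns {Ω : Type*} (σ : Multiset (Cycle Ω)) : ℕ :=
  (σ.map Cycle.length).lcm

/-- The rows of the table of `σ`, with multiplicity and unsorted: for each cycle `(s)` of `σ` and
each of the `|s|` rotations `t` of `s`, the power of `t` of length `numColumns σ`. -/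
def rows {Ω : Type*} (σ : Multiset (Cycle Ω)) : Multiset (List Ω) :=
  σ.bind (fun s => s.lists.map (fun t => wordPow t (numColumns σ / t.length)))

/-- The table of `σ`: its rows sorted into lexicographic order (`≤` on `List Ω`). -/
def table {Ω : Type*} [LinearOrder Ω] (σ : Multiset (Cycle Ω)) : List (List Ω) :=
  (rows σ).sort (· ≤ ·)

/-- The Extended Burrows-Wheeler Transform: the last column of the table, read from top to
bottom. (If `σ` is multicyclic, all rows are nonempty, so each row contributes one letter.) -/
def ebwt {Ω : Type*} [LinearOrder Ω] (σ : Multiset (Cycle Ω)) : List Ω :=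
  (table σ).filterMap List.getLast?

/-- The words that are rearrangements of the word in which each letter of `Ω` is written `m`
times. -/
def codewords (Ω : Type*) [Fintype Ω] (m : ℕ) : Language Ω :=
  {w : List Ω | (w : Multiset Ω) = m • (Finset.univ : Finset Ω).val}

/-- `W(m,q,k) = (mq)!^{q^{k-1}} / m!^{q^k}`, as a rational number (used for `k ≥ 1`). -/
def W (m q k : ℕ) : ℚ :=
  ((m * q).factorial : ℚ) ^ (q ^ (k - 1)) / (m.factorial : ℚ) ^ (q ^ k)

end MultiDeBruijn

/-! A multiset of aperiodic cycles is the same thing as a finite shift-invariant multiset of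
periodic infinite words: a cycle `(s)` corresponds to the shift orbit of `sss⋯`, and aperiodicity
makes the orbit have exactly `|s|` elements (`words_injOn`, `exists_words_eq`).

Sort these words as `X 0 ≤ X 1 ≤ ⋯`. The number of columns is a common period, so the transform `f`
lists the letters cyclically preceding the `X i`. Putting `f i` in front of each `X i` permutes the
family, and a stable sort by `f` puts it back in order. Hence each word is recovered from `f` by
iterating the standard permutation `Tuple.sort f` (`eq_unroll`). Conversely `unroll f` is sorted,
periodic and shift-invariant for every `f`, so the transform is a bijection from multisets of
aperiodic cycles onto all words (`ebwt_injOn`, `exists_ebwt_eq_ofFn`).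

Because the words are sorted, those beginning with a given `u` have consecutive indices, and the
occurrences of `a :: u` are the letters `a` of `f` at these indices (`prefixCount_cons`). If all
words of length `k + 1` occur `m` times, those of length `k` cut `f` into blocks of length `mq` with
each letter `m` times; the converse is an induction on the length of `u`. The count is then a power
of a multinomial coefficient. -/

namespace MultiDeBruijn

open Function

/-- The left shift on infinite words. -/
def shift {Ω : Type*} (x : ℕ → Ω) : ℕ → Ω := fun n => x (n + 1)

/-- The prefix of length `j` of an infinite word. -/
def pre {Ω : Type*} (j : ℕ) (x : ℕ → Ω) : List Ω := (List.range j).map x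

/-- The periodic infinite word `t t t ⋯`. -/
def per {Ω : Type*} [Inhabited Ω] (t : List Ω) : ℕ → Ω := fun n => t.getD (n % t.length) default

/-- The infinite words `t t t ⋯`, for all rotations `t` of a cycle. -/
def cycleWords {Ω : Type*} [Inhabited Ω] (s : Cycle Ω) : Multiset (ℕ → Ω) := s.lists.map per

/-- The infinite words `t t t ⋯`, for all rotations `t` of all cycles of a multiset. -/
def words {Ω : Type*} [Inhabited Ω] (σ : Multiset (Cycle Ω)) : Multiset (ℕ → Ω) :=
  σ.bind cycleWords

/-- The shortest cycle of a periodic infinite word. -/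
noncomputable def primitiveCycle {Ω : Type*} (x : ℕ → Ω) : Cycle Ω :=
  (periodicOrbit shift x).map fun y => y 0

/-! ### Prefixes of infinite words -/

section Prefixes

variable {Ω : Type*}

theorem iterate_shift_apply (x : ℕ → Ω) (d n : ℕ) : shift^[d] x n = x (n + d) := by
  induction d generalizing x with
  | zero => rfl
  | succ d ih => rw [iterate_succ_apply, ih]; simp only [shift]; congr 1

@[simp]
theorem length_pre (j : ℕ) (x : ℕ → Ω) : (pre j x).length = j := by simp [pre]

theorem getElem_pre (j : ℕ) (x : ℕ → Ω) (i : ℕ) (h : i < (pre j x).length) :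
    (pre j x)[i] = x i := by simp [pre]

theorem pre_succ (j : ℕ) (x : ℕ → Ω) : pre (j + 1) x = x 0 :: pre j (shift x) := by
  simp [pre, List.range_succ_eq_map, shift, Function.comp_def]

theorem pre_add (a b : ℕ) (x : ℕ → Ω) : pre (a + b) x = pre a x ++ pre b (shift^[a] x) := by
  rw [pre, List.range_add, List.map_append, List.map_map]
  congr 1
  apply List.map_congr_left
  intro i _
  rw [iterate_shift_apply, Function.comp_apply, add_comm]

theorem getLast?_pre {c : ℕ} (hc : 0 < c) (x : ℕ → Ω) : (pre c x).getLast? = some (x (c - 1)) := by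
  obtain ⟨c, rfl⟩ := Nat.exists_eq_succ_of_ne_zero hc.ne'
  simp [pre, List.range_succ]

theorem prefix_pre_iff (w : List Ω) (n : ℕ) (x : ℕ → Ω) :
    w <+: pre n x ↔ w.length ≤ n ∧ pre w.length x = w := by
  constructor
  · intro h
    have hl : w.length ≤ n := by simpa using h.length_le
    refine ⟨hl, List.ext_getElem (by simp) fun i h1 h2 => ?_⟩
    rw [getElem_pre, h.getElem h2, getElem_pre]
  · rintro ⟨h1, h2⟩
    obtain ⟨b, rfl⟩ := Nat.exists_eq_add_of_le h1
    rw [pre_add, h2]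
    exact List.prefix_append _ _

theorem lists_coe_eq_map_range {t : List Ω} (ht : t ≠ []) :
    (t : Cycle Ω).lists = ((List.range t.length).map t.rotate : Multiset (List Ω)) := by
  rw [Cycle.lists_coe]
  congr 1
  refine List.ext_getElem (by simp [List.length_cyclicPermutations_of_ne_nil _ ht]) fun i h1 h2 => ?_
  simp [List.getElem_cyclicPermutations]

theorem IsAperiodic.ne_nil {t : List Ω} (h : IsAperiodic (t : Cycle Ω)) : t ≠ [] := by
  rintro rfl
  simpa using h.1

theorem primitiveCycle_eq_coe (x : ℕ → Ω) :
    primitiveCycle x = (pre (minimalPeriod shift x) x : Cycle Ω) := by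
  rw [primitiveCycle, periodicOrbit_def, Cycle.map_coe, List.map_map, pre]
  congr 1
  apply List.map_congr_left
  intro d _
  simp [iterate_shift_apply]

end Prefixes

/-! ### Aperiodic cycles as shift orbits of periodic words -/

section Periodic

variable {Ω : Type*} [Inhabited Ω]

theorem iterate_shift_per (t : List Ω) (d : ℕ) : shift^[d] (per t) = per (t.rotate d) := by
  funext n
  rw [iterate_shift_apply]
  rcases t.length.eq_zero_or_pos with h0 | hpos
  · simp [per, List.length_eq_zero_iff.1 h0]
  · have h1 : (n + d) % t.length < t.length := Nat.mod_lt _ hpos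
    have h2 : n % (t.rotate d).length < (t.rotate d).length := Nat.mod_lt _ (by simpa using hpos)
    simp only [per]
    rw [List.getD_eq_getElem _ _ h1, List.getD_eq_getElem _ _ h2, List.getElem_rotate]
    simp

theorem iterate_shift_length_per (t : List Ω) : shift^[t.length] (per t) = per t := by
  rw [iterate_shift_per, List.rotate_length]

theorem pre_length_per (t : List Ω) : pre t.length (per t) = t := by
  refine List.ext_getElem (by simp) fun i h1 h2 => ?_
  rw [getElem_pre, per, Nat.mod_eq_of_lt h2, List.getD_eq_getElem _ _ h2]

theorem wordPow_eq_pre (t : List Ω) (r : ℕ) : wordPow t r = pre (r * t.length) (per t) := by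
  induction r with
  | zero => simp [wordPow, pre]
  | succ r ih =>
    rw [Nat.succ_mul, add_comm (r * t.length), pre_add, iterate_shift_length_per, ← ih, pre_length_per]
    simp [wordPow, List.replicate_succ]

theorem exists_prefix_wordPow_iff {t : List Ω} (ht : t ≠ []) (w : List Ω) :
    (∃ r : ℕ, w <+: wordPow t r) ↔ pre w.length (per t) = w := by
  simp only [wordPow_eq_pre, prefix_pre_iff]
  -- As `t` is nonempty, its power with exponent `w.length` is at least as long as `w`.
  refine ⟨fun ⟨r, h⟩ => h.2, fun h => ⟨w.length, ?_, h⟩⟩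
  exact Nat.le_mul_of_pos_right _ (List.length_pos_iff.2 ht)

theorem per_pre {x : ℕ → Ω} {p : ℕ} (hp : 0 < p) (hx : shift^[p] x = x) : per (pre p x) = x := by
  funext n
  have h : ∀ k n, x (n + k * p) = x n := by
    intro k
    induction k with
    | zero => simp
    | succ k ih =>
      intro n
      have := congrFun hx (n + k * p)
      rw [iterate_shift_apply, ih] at this
      rw [← this, Nat.succ_mul, add_assoc]
  have h1 : n % p < (pre p x).length := by simpa using Nat.mod_lt n hp
  rw [per, length_pre, List.getD_eq_getElem _ _ h1, getElem_pre, ← h (n / p) (n % p), mul_comm,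
    Nat.mod_add_div]

theorem cycleWords_coe {t : List Ω} (ht : t ≠ []) :
    cycleWords (t : Cycle Ω) =
      ((List.range t.length).map fun d => shift^[d] (per t) : Multiset (ℕ → Ω)) := by
  rw [cycleWords, lists_coe_eq_map_range ht, Multiset.map_coe, List.map_map]
  congr 1
  apply List.map_congr_left
  intro d _
  rw [iterate_shift_per, Function.comp_apply]

/-- A smaller positive period would be a nontrivial rotation fixing `t`, contradicting the
distinctness of the rotations. -/
theorem minimalPeriod_per {t : List Ω} (h : IsAperiodic (t : Cycle Ω)) :
    minimalPeriod shift (per t) = t.length := by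
  have hne := h.ne_nil
  have hper : IsPeriodicPt shift t.length (per t) := iterate_shift_length_per t
  have hpos : 0 < t.length := List.length_pos_iff.2 hne
  refine le_antisymm (hper.minimalPeriod_le hpos) (not_lt.1 fun hlt => ?_)
  have hp0 : 0 < minimalPeriod shift (per t) := hper.minimalPeriod_pos hpos
  have hrot : t.rotate (minimalPeriod shift (per t)) = t.rotate 0 := by
    have h1 := isPeriodicPt_minimalPeriod shift (per t)
    rw [IsPeriodicPt, IsFixedPt, iterate_shift_per] at h1
    have h2 := pre_length_per (t.rotate (minimalPeriod shift (per t)))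
    rw [h1, List.length_rotate, pre_length_per] at h2
    rw [← h2, List.rotate_zero]
  have hnd := h.2
  rw [lists_coe_eq_map_range hne, Multiset.coe_nodup, List.nodup_map_iff_inj_on List.nodup_range]
    at hnd
  exact hp0.ne' (hnd _ (List.mem_range.2 hlt) _ (List.mem_range.2 hpos) hrot)

theorem primitiveCycle_per {t : List Ω} (h : IsAperiodic (t : Cycle Ω)) :
    primitiveCycle (per t) = t := by
  rw [primitiveCycle_eq_coe, minimalPeriod_per h, pre_length_per]

theorem cycleWords_primitiveCycle {x : ℕ → Ω} (hx : x ∈ periodicPts shift) :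
    cycleWords (primitiveCycle x) =
      ((List.range (minimalPeriod shift x)).map fun d => shift^[d] x : Multiset (ℕ → Ω)) := by
  have hp := minimalPeriod_pos_of_mem_periodicPts hx
  have hne : pre (minimalPeriod shift x) x ≠ [] := by
    rw [← List.length_pos_iff, length_pre]; exact hp
  rw [primitiveCycle_eq_coe, cycleWords_coe hne, per_pre hp (iterate_minimalPeriod), length_pre]

theorem isAperiodic_primitiveCycle {x : ℕ → Ω} (hx : x ∈ periodicPts shift) :
    IsAperiodic (primitiveCycle x) := by
  have hp := minimalPeriod_pos_of_mem_periodicPts hx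
  refine ⟨by simpa [primitiveCycle_eq_coe] using hp, ?_⟩
  have h : (cycleWords (primitiveCycle x)).Nodup := by
    rw [cycleWords_primitiveCycle hx]
    exact (Cycle.nodup_coe_iff.1 (nodup_periodicOrbit (f := shift) (x := x)))
  exact Multiset.Nodup.of_map _ h

theorem primitiveCycle_of_mem_cycleWords {s : Cycle Ω} (hs : IsAperiodic s) {x : ℕ → Ω}
    (hx : x ∈ cycleWords s) : primitiveCycle x = s := by
  obtain ⟨t, ht, rfl⟩ := Multiset.mem_map.1 hx
  rw [Cycle.mem_lists_iff_coe_eq] at ht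
  subst ht
  exact primitiveCycle_per hs

theorem mem_cycleWords_primitiveCycle {x : ℕ → Ω} (hx : x ∈ periodicPts shift) :
    x ∈ cycleWords (primitiveCycle x) := by
  rw [cycleWords_primitiveCycle hx, Multiset.mem_coe, List.mem_map]
  exact ⟨0, List.mem_range.2 (minimalPeriod_pos_of_mem_periodicPts hx), rfl⟩

theorem exists_primitiveCycle_eq {s : Cycle Ω} (hs : IsAperiodic s) :
    ∃ x ∈ periodicPts shift, primitiveCycle x = s := by
  induction s using Quotient.inductionOn' with
  | _ t =>
    have hs' : IsAperiodic (t : Cycle Ω) := hs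
    exact ⟨per t, mk_mem_periodicPts (List.length_pos_iff.2 hs'.ne_nil)
      (iterate_shift_length_per t), primitiveCycle_per hs'⟩

theorem nodup_cycleWords {s : Cycle Ω} (hs : IsAperiodic s) : (cycleWords s).Nodup := by
  obtain ⟨x, hx, rfl⟩ := exists_primitiveCycle_eq hs
  rw [cycleWords_primitiveCycle hx]
  exact (Cycle.nodup_coe_iff.1 (nodup_periodicOrbit (f := shift) (x := x)))

theorem words_cons (s : Cycle Ω) (σ : Multiset (Cycle Ω)) :
    words (s ::ₘ σ) = cycleWords s + words σ := Multiset.cons_bind _ _ _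

open Classical in
-- Orbits of distinct aperiodic cycles are disjoint and repetition-free, so multiplicities of cycles
-- can be read off from multiplicities of words.
theorem count_words {σ : Multiset (Cycle Ω)} (hσ : IsMulticyclic σ) {x : ℕ → Ω}
    (hx : x ∈ periodicPts shift) : (words σ).count x = σ.count (primitiveCycle x) := by
  induction σ using Multiset.induction_on with
  | empty => simp [words]
  | cons s σ ih =>
    have hs : IsAperiodic s := hσ s (Multiset.mem_cons_self _ _)
    rw [words_cons, Multiset.count_add, ih fun t ht => hσ t (Multiset.mem_cons_of_mem ht),
      Multiset.count_cons, add_comm]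
    congr 1
    split_ifs with h
    · exact Multiset.count_eq_one_of_mem (nodup_cycleWords hs)
        (h ▸ mem_cycleWords_primitiveCycle hx)
    · exact Multiset.count_eq_zero_of_notMem fun h' => h (primitiveCycle_of_mem_cycleWords hs h')

theorem words_injOn : Set.InjOn (words (Ω := Ω)) {σ | IsMulticyclic σ} := by
  classical
  intro σ hσ τ hτ h
  ext s
  by_cases hs : IsAperiodic s
  · obtain ⟨x, hx, rfl⟩ := exists_primitiveCycle_eq hs
    rw [← count_words hσ hx, ← count_words hτ hx, h]
  · rw [Multiset.count_eq_zero_of_notMem fun h' => hs (hσ s h'),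
      Multiset.count_eq_zero_of_notMem fun h' => hs (hτ s h')]

theorem map_shift_cycleWords {s : Cycle Ω} (hs : IsAperiodic s) :
    (cycleWords s).map shift = cycleWords s := by
  obtain ⟨x, hx, rfl⟩ := exists_primitiveCycle_eq hs
  have h := iterate_minimalPeriod (f := shift) (x := x)
  have hp := minimalPeriod_pos_of_mem_periodicPts hx
  rw [cycleWords_primitiveCycle hx]
  obtain ⟨q, hq⟩ := Nat.exists_eq_succ_of_ne_zero hp.ne'
  rw [hq] at h ⊢
  rw [Multiset.map_coe, List.map_map, Multiset.coe_eq_coe]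
  conv_lhs => rw [List.range_succ, List.map_append]
  conv_rhs => rw [List.range_succ_eq_map, List.map_cons, List.map_map]
  have h1 : (List.range q).map (shift ∘ fun d => shift^[d] x) =
      (List.range q).map ((fun d => shift^[d] x) ∘ Nat.succ) :=
    List.map_congr_left fun d _ => (iterate_succ_apply' shift d x).symm
  have h2 : [q].map (shift ∘ fun d => shift^[d] x) = [x] := by
    simpa [← iterate_succ_apply' shift q x] using h
  rw [h1, h2]
  exact List.perm_append_comm

theorem map_shift_words {σ : Multiset (Cycle Ω)} (hσ : IsMulticyclic σ) :
    (words σ).map shift = words σ := by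
  rw [words, Multiset.map_bind]
  exact Multiset.bind_congr fun s hs => map_shift_cycleWords (hσ s hs)

/-- Shift-invariance puts the whole orbit of any member inside `M`. Removing one copy of the orbit
leaves a smaller invariant multiset, and the induction is on cardinality. -/
theorem exists_words_eq (M : Multiset (ℕ → Ω)) (hM : M.map shift = M)
    (hper : ∀ x ∈ M, x ∈ periodicPts shift) : ∃ σ, IsMulticyclic σ ∧ words σ = M := by
  classical
  induction hn : Multiset.card M using Nat.strong_induction_on generalizing M with
  | _ n ih =>
    rcases M.empty_or_exists_mem with rfl | ⟨x, hx⟩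
    · exact ⟨0, fun s hs => absurd hs (Multiset.notMem_zero s), rfl⟩
    · have hap := isAperiodic_primitiveCycle (hper x hx)
      have hle : cycleWords (primitiveCycle x) ≤ M := by
        rw [Multiset.le_iff_subset (nodup_cycleWords hap), cycleWords_primitiveCycle (hper x hx)]
        intro y hy
        obtain ⟨d, -, rfl⟩ := List.mem_map.1 (Multiset.mem_coe.1 hy)
        clear hy
        induction d with
        | zero => exact hx
        | succ d ihd =>
          rw [iterate_succ_apply', ← hM]
          exact Multiset.mem_map_of_mem _ ihd
      obtain ⟨M', rfl⟩ := Multiset.le_iff_exists_add.1 hle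
      rw [Multiset.map_add, map_shift_cycleWords hap] at hM
      have hpos : 0 < Multiset.card (cycleWords (primitiveCycle x)) :=
        Multiset.card_pos_iff_exists_mem.2 ⟨x, mem_cycleWords_primitiveCycle (hper x hx)⟩
      obtain ⟨σ, hσ, hw⟩ := ih (Multiset.card M') (by rw [← hn, Multiset.card_add]; omega) M'
        (add_left_cancel hM) (fun y hy => hper y (Multiset.mem_add.2 (Or.inr hy))) rfl
      refine ⟨primitiveCycle x ::ₘ σ, ?_, by rw [words_cons, hw]⟩
      intro s hs
      rcases Multiset.mem_cons.1 hs with rfl | hs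
      · exact hap
      · exact hσ s hs

end Periodic

end MultiDeBruijn

/-! ### The transform and its inverse -/

namespace MultiDeBruijn

open Function

/-- The infinite words reconstructed from a finite word `f`: iterate the standard permutation
of `f` and read off the letters. -/
def unroll {Ω : Type*} [LinearOrder Ω] {n : ℕ} (f : Fin n → Ω) (i : Fin n) : ℕ → Ω :=
  fun k => f ((Tuple.sort f)^[k + 1] i)

section Columns

theorem numColumns_pos {Ω : Type*} {σ : Multiset (Cycle Ω)} (hσ : IsMulticyclic σ) :
    0 < numColumns σ := by
  rw [numColumns, Nat.pos_iff_ne_zero, Ne, Multiset.lcm_eq_zero_iff, Multiset.mem_map]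
  rintro ⟨s, hs, h0⟩
  exact (hσ s hs).1.ne' h0

theorem length_dvd_numColumns {Ω : Type*} {σ : Multiset (Cycle Ω)} {s : Cycle Ω} (hs : s ∈ σ) :
    s.length ∣ numColumns σ :=
  Multiset.dvd_lcm (Multiset.mem_map_of_mem _ hs)

variable {Ω : Type*} [Inhabited Ω] {σ : Multiset (Cycle Ω)}

theorem iterate_shift_numColumns {x : ℕ → Ω} (hx : x ∈ words σ) :
    shift^[numColumns σ] x = x := by
  obtain ⟨s, hs, hx⟩ := Multiset.mem_bind.1 hx
  obtain ⟨t, ht, rfl⟩ := Multiset.mem_map.1 hx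
  rw [Cycle.mem_lists_iff_coe_eq] at ht
  subst ht
  have h : IsPeriodicPt shift t.length (per t) := iterate_shift_length_per t
  exact h.trans_dvd (length_dvd_numColumns hs)

theorem rows_eq_map_words : rows σ = (words σ).map (pre (numColumns σ)) := by
  rw [words, Multiset.map_bind, rows]
  refine Multiset.bind_congr fun s hs => ?_
  rw [cycleWords, Multiset.map_map]
  refine Multiset.map_congr rfl fun t ht => ?_
  rw [Cycle.mem_lists_iff_coe_eq] at ht
  subst ht
  rw [wordPow_eq_pre, Function.comp_apply]
  exact congrArg (pre · (per t)) (Nat.div_mul_cancel (length_dvd_numColumns hs))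

end Columns

section Transform

variable {Ω : Type*} [LinearOrder Ω]

theorem toLex_le_iff (x y : ℕ → Ω) :
    toLex x ≤ toLex y ↔ x 0 < y 0 ∨ x 0 = y 0 ∧ toLex (shift x) ≤ toLex (shift y) := by
  have lt_iff : ∀ x y : ℕ → Ω, toLex x < toLex y ↔ ∃ i, (∀ j < i, x j = y j) ∧ x i < y i :=
    fun x y => Iff.rfl
  have key : toLex x < toLex y ↔ x 0 < y 0 ∨ x 0 = y 0 ∧ toLex (shift x) < toLex (shift y) := by
    rw [lt_iff, lt_iff]
    constructor
    · rintro ⟨i, h1, h2⟩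
      cases i with
      | zero => exact Or.inl h2
      | succ i => exact Or.inr ⟨h1 0 i.succ_pos, i, fun j hj => h1 _ (Nat.succ_lt_succ hj), h2⟩
    · rintro (h | ⟨h0, i, h1, h2⟩)
      · exact ⟨0, fun j hj => absurd hj (Nat.not_lt_zero j), h⟩
      · refine ⟨i + 1, fun j hj => ?_, h2⟩
        cases j with
        | zero => exact h0
        | succ j => exact h1 j (Nat.lt_of_succ_lt_succ hj)
  have heq : x = y ↔ x 0 = y 0 ∧ shift x = shift y := by
    refine ⟨by rintro rfl; exact ⟨rfl, rfl⟩, fun ⟨h0, h1⟩ => funext fun k => ?_⟩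
    cases k with
    | zero => exact h0
    | succ k => exact congrFun h1 k
  have h1 : toLex x ≤ toLex y ↔ toLex x < toLex y ∨ toLex x = toLex y := le_iff_lt_or_eq
  have h2 : toLex (shift x) ≤ toLex (shift y) ↔
      toLex (shift x) < toLex (shift y) ∨ toLex (shift x) = toLex (shift y) := le_iff_lt_or_eq
  rw [h1, h2, key, toLex_inj, toLex_inj, heq]
  tauto

/-- Truncation preserves the weak order, so sorting the infinite words also sorts the rows; ties
between rows are harmless. -/
theorem pre_le_pre {x y : ℕ → Ω} (h : toLex x ≤ toLex y) (j : ℕ) : pre j x ≤ pre j y := by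
  induction j generalizing x y with
  | zero => simp [pre]
  | succ j ih =>
    rw [pre_succ, pre_succ]
    rcases (toLex_le_iff x y).1 h with h | ⟨h0, h⟩
    · exact le_of_lt (List.cons_lt_cons_iff.2 (Or.inl h))
    · rcases (ih h).lt_or_eq with h' | h'
      · exact le_of_lt (List.cons_lt_cons_iff.2 (Or.inr ⟨h0, h'⟩))
      · rw [h0, h']

theorem monotone_toLex_unroll {n : ℕ} (f : Fin n → Ω) : Monotone fun i => toLex (unroll f i) := by
  intro i j hij
  refine not_lt.1 fun hlt => ?_
  obtain ⟨k, h1, h2⟩ : ∃ k, (∀ l < k, unroll f j l = unroll f i l) ∧ unroll f j k < unroll f i k :=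
    hlt
  -- Before the first difference `k` the letters agree, and the stable sort keeps indices with equal
  -- letters in order. So the iterates are still ordered at step `k`, where sortedness of `f ∘
  -- Tuple.sort f` gives the contradiction.
  have key : ∀ l ≤ k, (Tuple.sort f)^[l] i ≤ (Tuple.sort f)^[l] j := by
    intro l
    induction l with
    | zero => exact fun _ => hij
    | succ l ih =>
      intro hl
      have h := h1 l hl
      simp only [unroll] at h
      rcases (ih (Nat.le_of_succ_le hl)).lt_or_eq with h' | h'
      · rw [iterate_succ_apply', iterate_succ_apply'] at h ⊢
        exact ((Tuple.eq_sort_iff.1 rfl).2 _ _ h' h.symm).le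
      · rw [iterate_succ_apply', iterate_succ_apply', h']
  have h3 := Tuple.monotone_sort f (key k le_rfl)
  simp only [unroll, iterate_succ_apply'] at h2
  exact absurd h2 (not_lt.2 h3)

theorem shift_unroll {n : ℕ} (f : Fin n → Ω) (i : Fin n) :
    shift (unroll f i) = unroll f (Tuple.sort f i) := rfl

theorem map_shift_unroll {n : ℕ} (f : Fin n → Ω) :
    (List.ofFn (unroll f) : Multiset (ℕ → Ω)).map shift = (List.ofFn (unroll f) : Multiset _) := by
  rw [Multiset.map_coe, List.map_ofFn, Multiset.coe_eq_coe]
  exact Equiv.Perm.ofFn_comp_perm (Tuple.sort f) (unroll f)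

theorem unroll_mem_periodicPts {n : ℕ} (f : Fin n → Ω) (i : Fin n) :
    unroll f i ∈ periodicPts shift := by
  have h : ∀ k, shift^[k] (unroll f i) = unroll f ((Tuple.sort f)^[k] i) := by
    intro k
    induction k with
    | zero => rfl
    | succ k ih => rw [iterate_succ_apply', ih, shift_unroll, iterate_succ_apply']
  refine mk_mem_periodicPts (orderOf_pos (Tuple.sort f)) ?_
  rw [IsPeriodicPt, IsFixedPt, h, ← Equiv.Perm.coe_pow, pow_orderOf_eq_one, Equiv.Perm.one_apply]

/-- A sorted family of infinite words which is, up to order, obtained from itself by putting the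
letters of `f` in front, is determined by `f`. -/
theorem eq_unroll {n : ℕ} (f : Fin n → Ω) (X Y : Fin n → ℕ → Ω)
    (hX : Monotone fun i => toLex (X i)) (hY0 : ∀ i, Y i 0 = f i) (hY : ∀ i, shift (Y i) = X i)
    (hXY : (List.ofFn Y).Perm (List.ofFn X)) : X = unroll f := by
  -- First letters are sorted; stability breaks ties by index, and the tails `X` increase with the
  -- index.
  have hmono : Monotone fun i => toLex (Y (Tuple.sort f i)) := by
    intro i j hij
    rw [toLex_le_iff, hY0, hY0, hY, hY]
    rcases (Tuple.monotone_sort f hij).lt_or_eq with h | h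
    · exact Or.inl h
    · refine Or.inr ⟨h, hX ?_⟩
      rcases hij.lt_or_eq with h' | h'
      · exact ((Tuple.eq_sort_iff.1 rfl).2 _ _ h' h).le
      · rw [h']
  have hperm : (List.ofFn fun i => toLex (Y (Tuple.sort f i))).Perm
      (List.ofFn fun i => toLex (X i)) := by
    have h1 := (Equiv.Perm.ofFn_comp_perm (Tuple.sort f) Y).trans hXY
    have h2 := h1.map toLex
    rw [List.map_ofFn, List.map_ofFn] at h2
    exact h2
  have heq := List.ofFn_injective
    (hperm.eq_of_sortedLE hmono.sortedLE_ofFn hX.sortedLE_ofFn)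
  -- Two sorted arrangements of one multiset coincide. This identity determines `X` letter by
  -- letter.
  have hXi : ∀ i, X i = Y (Tuple.sort f i) := fun i => toLex_inj.1 (congrFun heq i).symm
  funext i k
  induction k generalizing i with
  | zero => rw [hXi, hY0]; rfl
  | succ k ih => rw [hXi]; exact (congrFun (hY _) k).trans (ih _)

variable [Inhabited Ω] {σ : Multiset (Cycle Ω)}

theorem ebwt_eq_ofFn (hσ : IsMulticyclic σ) {n : ℕ} (X : Fin n → ℕ → Ω)
    (hX : Monotone fun i => toLex (X i)) (h : words σ = (List.ofFn X : Multiset (ℕ → Ω))) :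
    ebwt σ = List.ofFn fun i => X i (numColumns σ - 1) := by
  have htable : table σ = List.ofFn fun i => pre (numColumns σ) (X i) := by
    have hmono : Monotone fun i => pre (numColumns σ) (X i) := fun i j hij => pre_le_pre (hX hij) _
    refine List.Perm.eq_of_sortedLE (List.Pairwise.sortedLE (Multiset.pairwise_sort _ _))
      hmono.sortedLE_ofFn ?_
    rw [← Multiset.coe_eq_coe, table, Multiset.sort_eq, rows_eq_map_words, h, Multiset.map_coe,
      List.map_ofFn]
    rfl
  rw [ebwt, htable]
  rw [List.ofFn_comp' X, List.filterMap_map, List.ofFn_comp' X fun x => x (numColumns σ - 1),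
    ← List.filterMap_eq_map]
  congr 1
  funext x
  exact getLast?_pre (numColumns_pos hσ) x

theorem exists_ebwt_eq_and_words_eq (hσ : IsMulticyclic σ) :
    ∃ (n : ℕ) (f : Fin n → Ω), ebwt σ = List.ofFn f ∧
      words σ = (List.ofFn (unroll f) : Multiset (ℕ → Ω)) := by
  obtain ⟨n, X, hX, h⟩ : ∃ (n : ℕ) (X : Fin n → ℕ → Ω), (Monotone fun i => toLex (X i)) ∧
      words σ = (List.ofFn X : Multiset (ℕ → Ω)) := by
    refine ⟨_, fun i => ofLex ((((words σ).map toLex).sort (· ≤ ·)).get i), ?_, ?_⟩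
    · exact (List.Pairwise.sortedLE (Multiset.pairwise_sort _ _)).monotone_get
    · rw [List.ofFn_comp', List.ofFn_get, ← Multiset.map_coe, Multiset.sort_eq, Multiset.map_map]
      exact (Multiset.map_id _).symm
  have hc := numColumns_pos hσ
  refine ⟨n, fun i => X i (numColumns σ - 1), ebwt_eq_ofFn hσ X hX h, ?_⟩
  rw [h]
  congr 2
  -- Since `numColumns σ` is a period of `X i`, shifting by one less yields the last-column letter
  -- followed by `X i`.
  refine eq_unroll _ X (fun i => shift^[numColumns σ - 1] (X i)) hX
    (fun i => by rw [iterate_shift_apply, zero_add]) (fun i => ?_) ?_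
  · rw [← iterate_succ_apply' shift, Nat.succ_eq_add_one, Nat.sub_add_cancel hc]
    exact iterate_shift_numColumns (by rw [h]; exact List.mem_ofFn.2 ⟨i, rfl⟩)
  · rw [← Multiset.coe_eq_coe, List.ofFn_comp', ← Multiset.map_coe, ← h]
    generalize numColumns σ - 1 = d
    induction d with
    | zero => exact Multiset.map_id _
    | succ d ih =>
      have : shift^[d + 1] = (shift^[d] ∘ shift : (ℕ → Ω) → ℕ → Ω) := rfl
      rw [this, ← Multiset.map_map, map_shift_words hσ, ih]

theorem ebwt_injOn : Set.InjOn (ebwt (Ω := Ω)) {σ | IsMulticyclic σ} := by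
  intro σ hσ τ hτ h
  obtain ⟨n, f, hf, hσf⟩ := exists_ebwt_eq_and_words_eq hσ
  obtain ⟨n', f', hf', hτf'⟩ := exists_ebwt_eq_and_words_eq hτ
  rw [hf, hf'] at h
  have hn : n = n' := by simpa using congrArg List.length h
  subst hn
  obtain rfl := List.ofFn_injective h
  exact words_injOn hσ hτ (hσf.trans hτf'.symm)

theorem exists_ebwt_eq_ofFn {n : ℕ} (f : Fin n → Ω) :
    ∃ σ : Multiset (Cycle Ω), IsMulticyclic σ ∧ ebwt σ = List.ofFn f ∧
      words σ = (List.ofFn (unroll f) : Multiset (ℕ → Ω)) := by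
  obtain ⟨σ, hσ, h⟩ := exists_words_eq (List.ofFn (unroll f) : Multiset (ℕ → Ω))
    (map_shift_unroll f) (by
      intro x hx
      obtain ⟨i, rfl⟩ := List.mem_ofFn.1 (Multiset.mem_coe.1 hx)
      exact unroll_mem_periodicPts f i)
  refine ⟨σ, hσ, ?_, h⟩
  rw [ebwt_eq_ofFn hσ _ (monotone_toLex_unroll f) h]
  congr 1
  funext i
  -- The word at `(Tuple.sort f).symm i` is `f i` followed by `unroll f i`; by periodicity its
  -- letter `f i` recurs at position `numColumns σ`, the last column of row `i`.
  have hmem : unroll f ((Tuple.sort f).symm i) ∈ words σ := by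
    rw [h]; exact List.mem_ofFn.2 ⟨_, rfl⟩
  have h1 := congrFun (iterate_shift_numColumns hmem) 0
  have hc := numColumns_pos hσ
  rw [iterate_shift_apply, zero_add] at h1
  have h2 := congrFun (shift_unroll f ((Tuple.sort f).symm i)) (numColumns σ - 1)
  rw [Equiv.apply_symm_apply] at h2
  rw [← h2, shift, Nat.sub_add_cancel hc, h1]
  simp [unroll]

end Transform

end MultiDeBruijn

/-! ### Occurrences as blocks of sorted words -/

namespace MultiDeBruijn

open Function Finset

/-- The number of reconstructed infinite words of `f` which begin with `w`. -/
def prefixCount {Ω : Type*} [LinearOrder Ω] {n : ℕ} (f : Fin n → Ω) (w : List Ω) : ℕ :=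
  #{i | pre w.length (unroll f i) = w}

/-- The finite set of words of length `j`. -/
def kmers (Ω : Type*) [Fintype Ω] (j : ℕ) : Finset (List Ω) :=
  (univ : Finset (Fin j → Ω)).map ⟨List.ofFn, List.ofFn_injective⟩

/-- The number of elements of `V` below `v`. -/
def rank {β : Type*} [LinearOrder β] (V : Finset β) (v : β) : ℕ := #{u ∈ V | u < v}

section Ranks

variable {β : Type*} [LinearOrder β]

/-- If all fibers of a monotone map on `Fin n` have size `B`, they are consecutive blocks. -/
theorem apply_eq_iff_div_eq_rank {n B : ℕ} {g : Fin n → β} (hg : Monotone g) {V : Finset β}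
    (hV : ∀ i, g i ∈ V) (hB : ∀ v ∈ V, #{i | g i = v} = B) {v : β} (hv : v ∈ V) (i : Fin n) :
    g i = v ↔ (i : ℕ) / B = rank V v := by
  rw [rank]
  have hpos : 0 < B := by
    rw [← hB _ (hV i), Finset.card_pos]
    exact ⟨i, by simp⟩
  have hlt : #{i | g i < v} = #{u ∈ V | u < v} * B := by
    rw [card_eq_sum_card_fiberwise (f := g) (t := {u ∈ V | u < v})
      (fun i hi => by simpa [hV i] using hi)]
    refine sum_const_nat fun u hu => ?_
    rw [mem_filter] at hu
    rw [← hB u hu.1, filter_filter]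
    congr 1
    ext i
    simp only [mem_filter, mem_univ, true_and, and_iff_right_iff_imp]
    rintro rfl
    exact hu.2
  have hle : #{i | g i ≤ v} = (#{u ∈ V | u < v} + 1) * B := by
    have : (univ.filter fun i => g i ≤ v) =
        (univ.filter fun i => g i < v) ∪ univ.filter fun i => g i = v := by
      ext i; simp [le_iff_lt_or_eq]
    rw [this, card_union_of_disjoint, hlt, hB v hv, Nat.succ_mul]
    rw [disjoint_filter]
    exact fun i _ h => h.ne
  -- By monotonicity the indices with `g i < v` and with `g i ≤ v` form initial segments, of lengths
  -- `rank V v * B` and `(rank V v + 1) * B`.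
  have h1 := Tuple.lt_card_lt_iff_apply_lt_of_monotone (j := i) (a := v) hg
  have h2 := Tuple.lt_card_le_iff_apply_le_of_monotone (j := i) (a := v) hg
  rw [hlt] at h1
  rw [hle] at h2
  rw [Nat.div_eq_iff hpos, le_antisymm_iff, ← h2, ← not_lt, ← h1, not_lt, Nat.succ_mul]
  omega

theorem rank_lt_card {V : Finset β} {v : β} (hv : v ∈ V) : rank V v < #V :=
  card_lt_card ⟨filter_subset _ _, fun h => lt_irrefl v (mem_filter.1 (h hv)).2⟩

theorem exists_rank_eq (V : Finset β) {r : ℕ} (hr : r < #V) : ∃ v ∈ V, rank V v = r := by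
  have hinj : Set.InjOn (rank V) V := by
    have hlt : ∀ v ∈ V, ∀ w, v < w → rank V v < rank V w := by
      intro v hv w hvw
      refine card_lt_card ⟨fun u hu => ?_, fun h => ?_⟩
      · rw [mem_filter] at hu ⊢
        exact ⟨hu.1, hu.2.trans hvw⟩
      · exact lt_irrefl v (mem_filter.1 (h (mem_filter.2 ⟨hv, hvw⟩))).2
    intro v hv w hw h
    rcases lt_trichotomy v w with h' | h' | h'
    · exact absurd h (hlt v hv w h').ne
    · exact h'
    · exact absurd h (hlt w hw v h').ne'
  have himage : V.image (rank V) = range #V := by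
    refine eq_of_subset_of_card_le (fun r hr => ?_) ?_
    · obtain ⟨v, hv, rfl⟩ := mem_image.1 hr
      exact mem_range.2 (rank_lt_card hv)
    · rw [card_image_of_injOn hinj, card_range]
  have := mem_range.2 hr
  rw [← himage] at this
  exact mem_image.1 this

end Ranks

section Kmers

variable {Ω : Type*} [Fintype Ω]

theorem mem_kmers {j : ℕ} {w : List Ω} : w ∈ kmers Ω j ↔ w.length = j := by
  simp only [kmers, mem_map, mem_univ, true_and, Embedding.coeFn_mk]
  constructor
  · rintro ⟨f, rfl⟩
    simp
  · rintro rfl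
    exact ⟨w.get, List.ofFn_get w⟩

theorem card_kmers (j : ℕ) : #(kmers Ω j) = Fintype.card Ω ^ j := by
  simp [kmers]

end Kmers

section Counts

variable {Ω : Type*} [LinearOrder Ω] {n : ℕ} (f : Fin n → Ω)

theorem cycleOccurrences_eq [Inhabited Ω] {s : Cycle Ω} (hs : IsAperiodic s) (w : List Ω) :
    cycleOccurrences s w = (cycleWords s).countP fun x => pre w.length x = w := by
  classical
  rw [cycleOccurrences, cycleWords, Multiset.countP_map, ← Multiset.countP_eq_card_filter]
  refine Multiset.countP_congr rfl fun t ht => ?_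
  rw [Cycle.mem_lists_iff_coe_eq] at ht
  subst ht
  exact propext (exists_prefix_wordPow_iff hs.ne_nil w)

theorem occurrences_eq_prefixCount [Inhabited Ω] {σ : Multiset (Cycle Ω)} (hσ : IsMulticyclic σ)
    (h : words σ = (List.ofFn (unroll f) : Multiset (ℕ → Ω))) (w : List Ω) :
    occurrences σ w = prefixCount f w := by
  have key : occurrences σ w = (words σ).countP fun x => pre w.length x = w := by
    clear h
    induction σ using Multiset.induction_on with
    | empty => simp [occurrences, words]
    | cons s σ ih =>
      rw [words_cons, Multiset.countP_add, ← cycleOccurrences_eq (hσ s (Multiset.mem_cons_self _ _)),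
        ← ih fun t ht => hσ t (Multiset.mem_cons_of_mem ht), occurrences, Multiset.map_cons,
        Multiset.sum_cons, occurrences]
  rw [key, h, ← Fin.univ_val_map, Multiset.countP_map]
  rfl

/-- Reindexing along the standard permutation moves from a word to its shift, where the removed
first letter is read off from `f`. -/
theorem prefixCount_cons (a : Ω) (u : List Ω) :
    prefixCount f (a :: u) = #{i | f i = a ∧ pre u.length (unroll f i) = u} := by
  refine card_equiv (Tuple.sort f) fun i => ?_
  rw [mem_filter, mem_filter, List.length_cons, pre_succ, List.cons.injEq, shift_unroll]
  simp [unroll]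

/-- Occurrences are sorted by the letter that precedes them. -/
theorem prefixCount_eq_sum [Fintype Ω] (u : List Ω) :
    prefixCount f u = ∑ a, prefixCount f (a :: u) := by
  rw [prefixCount, card_eq_sum_card_fiberwise (f := f) (t := univ) (by simp)]
  refine sum_congr rfl fun a _ => ?_
  rw [prefixCount_cons, filter_filter]
  simp only [and_comm]

theorem monotone_pre_unroll (j : ℕ) : Monotone fun i => pre j (unroll f i) :=
  fun _ _ hij => pre_le_pre (monotone_toLex_unroll f hij) j

theorem pre_unroll_eq_iff [Fintype Ω] {j B : ℕ}
    (h : ∀ u : List Ω, u.length = j → prefixCount f u = B)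
    {u : List Ω} (hu : u.length = j) (i : Fin n) :
    pre j (unroll f i) = u ↔ (i : ℕ) / B = rank (kmers Ω j) u := by
  refine apply_eq_iff_div_eq_rank (monotone_pre_unroll f j) (fun i => mem_kmers.2 (length_pre _ _))
    (fun v hv => ?_) (mem_kmers.2 hu) i
  rw [mem_kmers] at hv
  subst hv
  convert h v rfl
  rw [prefixCount]
  congr!

variable [Fintype Ω] {m k : ℕ}

/-- If every word of length `k + 1` occurs exactly `m` times, then `f` is made up of blocks in which
each letter occurs exactly `m` times. -/
theorem balanced_of_prefixCount (h : ∀ w : List Ω, w.length = k + 1 → prefixCount f w = m) :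
    n = Fintype.card Ω ^ k * (m * Fintype.card Ω) ∧ ∀ r < Fintype.card Ω ^ k, ∀ a,
      #{i : Fin n | (i : ℕ) / (m * Fintype.card Ω) = r ∧ f i = a} = m := by
  -- Summing over left extensions; so block `r` of length `m * Fintype.card Ω` belongs to the word
  -- of length `k` and rank `r`.
  have hk : ∀ u : List Ω, u.length = k → prefixCount f u = m * Fintype.card Ω := by
    intro u hu
    rw [prefixCount_eq_sum, sum_congr rfl fun a _ => h (a :: u) (by simp [hu])]
    simp [mul_comm]
  constructor
  · have := card_eq_sum_card_fiberwise (s := (univ : Finset (Fin n)))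
      (f := fun i => pre k (unroll f i)) (t := kmers Ω k)
      (fun i _ => mem_kmers.2 (length_pre _ _))
    rw [card_univ, Fintype.card_fin] at this
    rw [this, ← card_kmers]
    refine sum_const_nat fun u hu => ?_
    rw [mem_kmers] at hu
    rw [← hk u hu, prefixCount, hu]
  · intro r hr a
    rw [← card_kmers] at hr
    obtain ⟨u, hu, rfl⟩ := exists_rank_eq _ hr
    rw [mem_kmers] at hu
    refine Eq.trans ?_ (h (a :: u) (by simp [hu]))
    rw [prefixCount_cons, hu]
    simp only [pre_unroll_eq_iff f hk hu, and_comm]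

/-- If `f` is made up of blocks in which each letter occurs exactly `m` times, then every word of
length `k + 1` occurs exactly `m` times. -/
theorem prefixCount_of_balanced (hn : n = Fintype.card Ω ^ k * (m * Fintype.card Ω))
    (h : ∀ r < Fintype.card Ω ^ k, ∀ a,
      #{i : Fin n | (i : ℕ) / (m * Fintype.card Ω) = r ∧ f i = a} = m)
    (w : List Ω) (hw : w.length = k + 1) : prefixCount f w = m := by
  have key : ∀ j ≤ k + 1, ∀ u : List Ω, u.length = j →
      prefixCount f u = m * Fintype.card Ω ^ (k + 1 - j) := by
    intro j
    induction j with
    | zero =>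
      intro _ u hu
      rw [List.length_eq_zero_iff] at hu
      subst hu
      simp only [prefixCount, pre, List.length_nil, List.range_zero, List.map_nil, filter_true,
        card_univ, Fintype.card_fin]
      rw [hn, Nat.sub_zero]
      ring
    | succ j ih =>
      intro hj u hu
      have ih' := ih (Nat.le_of_succ_le hj)
      have hjk : j ≤ k := Nat.le_of_succ_le_succ hj
      obtain ⟨a, u, rfl⟩ := List.exists_cons_of_length_eq_add_one hu
      have hu' : u.length = j := by simpa using hu
      -- The indices for `u` form block `ρ` of this larger size, a union of `P = q ^ (k - j)`
      -- consecutive balanced blocks, each contributing `m` letters `a`.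
      have hB : m * Fintype.card Ω ^ (k + 1 - j) =
          (m * Fintype.card Ω) * Fintype.card Ω ^ (k - j) := by
        rw [Nat.succ_sub hjk, pow_succ]; ring
      have hP : k + 1 - (j + 1) = k - j := by omega
      rw [prefixCount_cons, hu', hP]
      simp only [pre_unroll_eq_iff f ih' hu']
      rw [hB]
      set ρ := rank (kmers Ω j) u with hρ
      set P := Fintype.card Ω ^ (k - j) with hPdef
      have hρlt : ρ < Fintype.card Ω ^ j := by
        rw [← card_kmers]; exact rank_lt_card (mem_kmers.2 hu')
      have hqk : Fintype.card Ω ^ k = Fintype.card Ω ^ j * P := by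
        rw [hPdef, ← pow_add, Nat.add_sub_cancel' hjk]
      have hPpos : 0 < P := Nat.pow_pos (Fintype.card_pos_iff.2 ⟨a⟩)
      rw [card_eq_sum_card_fiberwise (f := fun i : Fin n => (i : ℕ) / (m * Fintype.card Ω))
        (t := Ico (ρ * P) (ρ * P + P))]
      · rw [sum_const_nat (m := m), Nat.card_Ico, Nat.add_sub_cancel_left, mul_comm]
        intro s hs
        rw [mem_Ico] at hs
        have hs' : s < Fintype.card Ω ^ k := by
          rw [hqk]
          refine hs.2.trans_le ?_
          rw [← Nat.succ_mul]
          exact Nat.mul_le_mul_right _ hρlt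
        refine Eq.trans ?_ (h s hs' a)
        rw [filter_filter]
        congr 1
        ext i
        simp only [mem_filter, mem_univ, true_and]
        rw [and_comm]
        refine and_congr_right fun hi => ?_
        rw [← Nat.div_div_eq_div_mul, hi]
        refine and_iff_left ?_
        rw [Nat.div_eq_iff hPpos]
        omega
      · intro i hi
        simp only [coe_filter, mem_univ, true_and, Set.mem_ofPred_eq, coe_Ico, Set.mem_Ico] at hi ⊢
        have := hi.2
        rw [← Nat.div_div_eq_div_mul, Nat.div_eq_iff hPpos] at this
        omega
  rw [key (k + 1) le_rfl w hw, Nat.sub_self, pow_zero, mul_one]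

end Counts

end MultiDeBruijn

/-! ### Arrangements of a multiset -/

namespace MultiDeBruijn

open Finset

/-- The words whose letters form the multiset `s`. -/
noncomputable def arrangements {α : Type*} [DecidableEq α] (s : Multiset α) : Finset (List α) :=
  s.toList.permutations.toFinset

section Arrangements

variable {α : Type*} [DecidableEq α]

theorem mem_arrangements {s : Multiset α} {l : List α} :
    l ∈ arrangements s ↔ (l : Multiset α) = s := by
  rw [arrangements, List.mem_toFinset, List.mem_permutations, ← Multiset.coe_eq_coe,
    Multiset.coe_toList]

theorem arrangements_eq_biUnion {s : Multiset α} (hs : s ≠ 0) :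
    arrangements s = s.toFinset.biUnion fun a =>
      (arrangements (s.erase a)).map ⟨List.cons a, List.cons_injective⟩ := by
  ext l
  simp only [mem_biUnion, mem_map, mem_arrangements, Multiset.mem_toFinset,
    Function.Embedding.coeFn_mk]
  constructor
  · rintro rfl
    cases l with
    | nil => exact absurd rfl hs
    | cons a l => exact ⟨a, by simp, l, by simp, rfl⟩
  · rintro ⟨a, ha, l, hl, rfl⟩
    rw [← Multiset.cons_coe, hl, Multiset.cons_erase ha]

theorem prod_factorial_count_cons [Fintype α] (a : α) (s : Multiset α) :
    ∏ b, ((a ::ₘ s).count b).factorial =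
      (s.count a + 1) * ∏ b, (s.count b).factorial := by
  rw [← mul_prod_erase univ _ (mem_univ a), ← mul_prod_erase univ (fun b => (s.count b).factorial)
    (mem_univ a), Multiset.count_cons_self, Nat.factorial_succ, mul_assoc]
  congr 2
  refine prod_congr rfl fun b hb => ?_
  rw [Multiset.count_cons_of_ne (ne_of_mem_erase hb)]

/-- Classify by first letter: arrangements starting with `a` contribute `s.count a * n.factorial`,
and the multiplicities add up to `n + 1`. -/
theorem card_arrangements_mul [Fintype α] (s : Multiset α) :
    #(arrangements s) * ∏ a, (s.count a).factorial = (Multiset.card s).factorial := by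
  induction hn : Multiset.card s generalizing s with
  | zero =>
    rw [Multiset.card_eq_zero] at hn
    subst hn
    simp [arrangements]
  | succ n ih =>
    have hs : s ≠ 0 := by rintro rfl; simp at hn
    rw [arrangements_eq_biUnion hs, card_biUnion, sum_mul]
    · have h : ∀ a ∈ s.toFinset,
          #((arrangements (s.erase a)).map ⟨List.cons a, List.cons_injective⟩) *
            ∏ b, (s.count b).factorial = s.count a * n.factorial := by
        intro a ha
        rw [Multiset.mem_toFinset] at ha
        obtain ⟨t, rfl⟩ := Multiset.exists_cons_of_mem ha
        rw [Multiset.card_cons, Nat.add_right_cancel_iff] at hn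
        rw [card_map, Multiset.erase_cons_head, prod_factorial_count_cons,
          Multiset.count_cons_self, ← ih t hn]
        ring
      rw [sum_congr rfl h, ← sum_mul, Multiset.toFinset_sum_count_eq, hn, Nat.factorial_succ]
    · intro a _ b _ hab
      rw [Function.onFun, disjoint_left]
      simp only [mem_map, Function.Embedding.coeFn_mk]
      rintro l ⟨l₁, -, rfl⟩ ⟨l₂, -, h⟩
      exact hab (List.cons.inj h).1.symm

end Arrangements

/-! ### Concatenations of codewords -/

section Blocks

/-- Blocks of a common length can be cut off one at a time. The numbers of blocks are assumed equal
because `B` may be `0`. -/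
theorem eq_of_flatten_eq {α : Type*} {B : ℕ} {S T : List (List α)} (hl : S.length = T.length)
    (hS : ∀ y ∈ S, y.length = B) (hT : ∀ y ∈ T, y.length = B) (h : S.flatten = T.flatten) :
    S = T := by
  induction S generalizing T with
  | nil => exact (List.length_eq_zero_iff.1 hl.symm).symm
  | cons s S ih =>
    obtain ⟨t, T, rfl⟩ := List.exists_cons_of_length_eq_add_one hl.symm
    rw [List.forall_mem_cons] at hS hT
    rw [List.flatten_cons, List.flatten_cons] at h
    obtain ⟨rfl, h'⟩ := List.append_inj h (hS.1.trans hT.1.symm)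
    rw [ih (Nat.succ.inj hl) hS.2 hT.2 h']

variable {Ω : Type*} [Fintype Ω] {m N : ℕ}

theorem mem_codewords_iff {w : List Ω} :
    w ∈ codewords Ω m ↔ (w : Multiset Ω) = m • (univ : Finset Ω).val := Iff.rfl

theorem length_of_mem_codewords {w : List Ω} (hw : w ∈ codewords Ω m) :
    w.length = m * Fintype.card Ω := by
  rw [← Multiset.coe_card, mem_codewords_iff.1 hw, Multiset.card_nsmul, card_val, card_univ]

theorem length_of_mem_codewords_pow {w : List Ω} (hw : w ∈ codewords Ω m ^ N) :
    w.length = N * (m * Fintype.card Ω) := by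
  obtain ⟨S, rfl, rfl, hS⟩ := Language.mem_pow.1 hw
  rw [List.length_flatten, List.map_congr_left fun y hy => length_of_mem_codewords (hS y hy)]
  simp

variable [LinearOrder Ω]

theorem ofFn_mem_codewords_iff {B : ℕ} (g : Fin B → Ω) :
    List.ofFn g ∈ codewords Ω m ↔ ∀ a, #{j | g j = a} = m := by
  rw [mem_codewords_iff, ← Fin.univ_val_map, Multiset.ext]
  refine forall_congr' fun a => ?_
  rw [Multiset.count_nsmul, Multiset.count_univ, mul_one, Multiset.count_map]
  simp only [eq_comm (a := a)]
  rfl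

theorem ofFn_mem_codewords_pow_iff {n : ℕ} (f : Fin n → Ω) (hn : n = N * (m * Fintype.card Ω)) :
    List.ofFn f ∈ codewords Ω m ^ N ↔ ∀ r < N, ∀ a,
      #{i : Fin n | (i : ℕ) / (m * Fintype.card Ω) = r ∧ f i = a} = m := by
  obtain ⟨B, hB⟩ : ∃ B, B = m * Fintype.card Ω := ⟨_, rfl⟩
  rw [← hB] at hn ⊢
  subst hn
  have hlt : ∀ (r : Fin N) (j : Fin B), (r : ℕ) * B + j < N * B := fun r j =>
    calc (r : ℕ) * B + j < (r + 1) * B := by rw [Nat.succ_mul]; omega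
      _ ≤ N * B := Nat.mul_le_mul_right _ r.2
  have hflat : List.ofFn f =
      (List.ofFn fun r : Fin N => List.ofFn fun j : Fin B => f ⟨r * B + j, hlt r j⟩).flatten :=
    List.ofFn_mul f
  have hiff : List.ofFn f ∈ codewords Ω m ^ N ↔
      ∀ r : Fin N, (List.ofFn fun j : Fin B => f ⟨r * B + j, hlt r j⟩) ∈ codewords Ω m := by
    rw [Language.mem_pow]
    constructor
    · rintro ⟨S, h1, h2, h3⟩ r
      have hS := eq_of_flatten_eq (B := B) (by rw [h2, List.length_ofFn])
        (fun y hy => (length_of_mem_codewords (h3 y hy)).trans hB.symm)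
        (fun y hy => by obtain ⟨i, rfl⟩ := List.mem_ofFn.1 hy; exact List.length_ofFn)
        (h1.symm.trans hflat)
      exact h3 _ (by rw [hS]; exact List.mem_ofFn.2 ⟨r, rfl⟩)
    · intro h
      refine ⟨_, hflat, List.length_ofFn, fun y hy => ?_⟩
      obtain ⟨r, rfl⟩ := List.mem_ofFn.1 hy
      exact h r
  rw [hiff, Fin.forall_iff]
  refine forall_congr' fun r => forall_congr' fun hr => ?_
  rw [ofFn_mem_codewords_iff]
  refine forall_congr' fun a => ?_
  refine Eq.congr_left (card_bij (fun j _ => ⟨r * B + j, hlt ⟨r, hr⟩ j⟩) ?_ ?_ ?_)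
  · intro j hj
    rw [mem_filter] at hj ⊢
    refine ⟨mem_univ _, ?_, hj.2⟩
    rw [Nat.div_eq_iff (Nat.pos_of_ne_zero fun h0 => by have := j.2; omega)]
    have := j.2
    simp only
    omega
  · intro j _ j' _ h
    rw [Fin.mk.injEq] at h
    exact Fin.ext (by omega)
  · intro i hi
    rw [mem_filter] at hi
    have hBpos : 0 < B := Nat.pos_of_ne_zero fun h0 => by
      have := i.2
      simp [h0] at this
    have hi' : r * B + i % B = i := by rw [← hi.2.1]; exact Nat.div_add_mod' _ _
    refine ⟨⟨i % B, Nat.mod_lt _ hBpos⟩, ?_, Fin.ext hi'⟩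
    rw [mem_filter]
    refine ⟨mem_univ _, ?_⟩
    rw [← hi.2.2]
    exact congrArg f (Fin.ext hi')

theorem mem_arrangements_iff_mem_codewords {w : List Ω} :
    w ∈ arrangements (m • (univ : Finset Ω).val) ↔ w ∈ codewords Ω m := mem_arrangements

theorem card_arrangements_codewords :
    #(arrangements (m • (univ : Finset Ω).val)) * m.factorial ^ Fintype.card Ω =
      (m * Fintype.card Ω).factorial := by
  have h := card_arrangements_mul (m • (univ : Finset Ω).val)
  simpa [Multiset.count_nsmul, Multiset.card_nsmul] using h

theorem codewords_pow_eq_range : {w : List Ω | w ∈ codewords Ω m ^ N} =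
    Set.range fun g : Fin N → arrangements (m • (univ : Finset Ω).val) =>
      (List.ofFn fun i => (g i : List Ω)).flatten := by
  ext w
  rw [Set.mem_ofPred_eq, Language.mem_pow]
  constructor
  · rintro ⟨S, rfl, rfl, hS⟩
    refine ⟨fun i => ⟨S.get i, mem_arrangements_iff_mem_codewords.2 (hS _ (S.get_mem i))⟩, ?_⟩
    simp only [List.ofFn_get]
  · rintro ⟨g, rfl⟩
    refine ⟨_, rfl, List.length_ofFn, fun y hy => ?_⟩
    obtain ⟨i, rfl⟩ := List.mem_ofFn.1 hy
    exact mem_arrangements_iff_mem_codewords.1 (g i).2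

theorem finite_codewords_pow : {w : List Ω | w ∈ codewords Ω m ^ N}.Finite := by
  rw [codewords_pow_eq_range]
  exact Set.finite_range _

theorem ncard_codewords_pow : {w : List Ω | w ∈ codewords Ω m ^ N}.ncard =
    #(arrangements (m • (univ : Finset Ω).val)) ^ N := by
  have hinj : Function.Injective fun g : Fin N → arrangements (m • (univ : Finset Ω).val) =>
      (List.ofFn fun i => (g i : List Ω)).flatten := by
    have hlen : ∀ (g : Fin N → arrangements (m • (univ : Finset Ω).val)),
        ∀ y ∈ List.ofFn fun i => (g i : List Ω), y.length = m * Fintype.card Ω := by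
      intro g y hy
      obtain ⟨i, rfl⟩ := List.mem_ofFn.1 hy
      exact length_of_mem_codewords (mem_arrangements_iff_mem_codewords.1 (g i).2)
    intro g g' h
    have := List.ofFn_injective (eq_of_flatten_eq (by simp) (hlen g) (hlen g') h)
    exact funext fun i => Subtype.ext (congrFun this i)
  rw [codewords_pow_eq_range, ← Set.image_univ, Set.ncard_image_of_injective _ hinj,
    Set.ncard_univ]
  simp

theorem image_ebwt_MCDB [Nonempty Ω] (m k : ℕ) :
    ebwt '' MCDB Ω m (k + 1) = {w : List Ω | w ∈ codewords Ω m ^ Fintype.card Ω ^ k} := by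
  inhabit Ω
  ext w
  constructor
  · rintro ⟨σ, ⟨hσ, hocc⟩, rfl⟩
    obtain ⟨n, f, hf, hwords⟩ := exists_ebwt_eq_and_words_eq hσ
    obtain ⟨hn, hbal⟩ := balanced_of_prefixCount f fun w hw =>
      (occurrences_eq_prefixCount f hσ hwords w).symm.trans (hocc w hw)
    rw [hf]
    exact (ofFn_mem_codewords_pow_iff f hn).2 hbal
  · intro hw
    have hn := length_of_mem_codewords_pow hw
    obtain ⟨σ, hσ, hebwt, hwords⟩ := exists_ebwt_eq_ofFn w.get
    rw [← List.ofFn_get w] at hw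
    have hbal := (ofFn_mem_codewords_pow_iff w.get hn).1 hw
    refine ⟨σ, ⟨hσ, fun v hv => ?_⟩, by rw [hebwt, List.ofFn_get]⟩
    rw [occurrences_eq_prefixCount _ hσ hwords]
    exact prefixCount_of_balanced _ hn hbal v hv

end Blocks

end MultiDeBruijn

theorem mainTheorem4 {Ω : Type*} [LinearOrder Ω] [Fintype Ω] (m q k : ℕ)
    (hΩ : Fintype.card Ω = q) (hm : 1 ≤ m) (hq : 1 ≤ q) (hk : 1 ≤ k) :
    MultiDeBruijn.ebwt '' MultiDeBruijn.MCDB Ω m k =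
        {w : List Ω | w ∈ MultiDeBruijn.codewords Ω m ^ (q ^ (k - 1))} ∧
      (MultiDeBruijn.MCDB Ω m k).Finite ∧
      ((MultiDeBruijn.MCDB Ω m k).ncard : ℚ) = MultiDeBruijn.W m q k := by
  subst hΩ
  have : Nonempty Ω := Fintype.card_pos_iff.1 hq
  inhabit Ω
  obtain ⟨k, rfl⟩ := Nat.exists_eq_add_of_le' hk
  have himage := MultiDeBruijn.image_ebwt_MCDB (Ω := Ω) m k
  have hinj : Set.InjOn MultiDeBruijn.ebwt (MultiDeBruijn.MCDB Ω m (k + 1)) :=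
    MultiDeBruijn.ebwt_injOn.mono fun _ h => h.1
  refine ⟨himage, Set.Finite.of_finite_image ?_ hinj, ?_⟩
  · rw [himage]
    exact MultiDeBruijn.finite_codewords_pow
  · have hfac : (m.factorial : ℚ) ≠ 0 := Nat.cast_ne_zero.2 m.factorial_ne_zero
    rw [← hinj.ncard_image, himage, MultiDeBruijn.ncard_codewords_pow,
      MultiDeBruijn.W, Nat.add_sub_cancel, eq_div_iff (pow_ne_zero _ hfac),
      ← MultiDeBruijn.card_arrangements_codewords]
    push_cast
    rw [mul_pow, ← pow_mul, pow_succ' (Fintype.card Ω)]
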